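/- A ReLU network of depth $k+1$ (with $k\ge 0$ hidden layers) and input dimension $n$ is given by affine maps $t^{(i)}\colon\mathbb{R}^{n_{i-1}}\to\mathbb{R}^{n_i}$, $t^{(i)}(x)=A^{(i)}x+b^{(i)}$, $i=1,\dots,k+1$, with real matrices $A^{(i)}$, real vectors $b^{(i)}$, $n_0=n$ and $n_{k+1}=1$. It represents the function $t^{(k+1)}\circ\sigma\circ t^{(k)}\circ\cdots\circ\sigma\circ t^{(1)}\colon\mathbb{R}^n\to\mathbb{R}$, where $\sigma(y)=\max\{0,y\}$ is applied componentwise. The entries of the matrices $A^{(i)}$ are its weights; the biases, i.e. the entries of the $b^{(i)}$, may be arbitrary real numbers. An $N$-ary fraction is a number of the form $z/N^t$ with $z\in\mathbb{Z}$ and $t\in\mathbb{Z}_{\ge 0}$. Theorem. There is an absolute constant $C>0$ such that, for all integers $n\ge 3$ and $N\ge 3$, every ReLU network all of whose weights are $N$-ary fractions and that represents the function $(x_1,\dots,x_n)\mapsto\max\{0,x_1,\dots,x_n\}$ on $\mathbb{R}^n$ has depth at least $$C\cdot\frac{\ln n}{\ln\ln N}.$$ -/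

import Mathlib

/-- A ReLU network with `n` inputs and `m` outputs, given by its affine transformations
`x ↦ A x + b`, listed from the input to the output. Widths and number of layers are arbitrary. -/
inductive ReLUNetwork (m : ℕ) : ℕ → Type
  /-- The network with a single layer, `x ↦ A x + b`, without hidden layers. -/
  | output {n : ℕ} (A : Matrix (Fin m) (Fin n) ℝ) (b : Fin m → ℝ) : ReLUNetwork m n
  /-- A hidden layer `x ↦ σ (A x + b)` with `l` units, followed by the network `rest`. -/
  | hidden {n l : ℕ} (A : Matrix (Fin l) (Fin n) ℝ) (b : Fin l → ℝ)
      (rest : ReLUNetwork m l) : ReLUNetwork m n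

namespace ReLUNetwork

/-- The number of hidden layers. -/
def numHidden {m : ℕ} : {n : ℕ} → ReLUNetwork m n → ℕ
  | _, output _ _ => 0
  | _, hidden _ _ rest => rest.numHidden + 1

/-- The depth is the number of affine transformations. -/
def depth {m n : ℕ} (net : ReLUNetwork m n) : ℕ := net.numHidden + 1

/-- The function computed by the network: the alternating composition of its affine
transformations with the componentwise ReLU function `max 0`. -/
noncomputable def eval {m : ℕ} : {n : ℕ} → ReLUNetwork m n → (Fin n → ℝ) → (Fin m → ℝ)
  | _, output A b => fun x => A.mulVec x + b
  | _, hidden A b rest => fun x => rest.eval (fun i => max 0 ((A.mulVec x + b) i))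

/-- All weights (the entries of the matrices, not the biases) lie in `R`. -/
def WeightsIn {m : ℕ} (R : Set ℝ) : {n : ℕ} → ReLUNetwork m n → Prop
  | _, output A _ => ∀ i j, A i j ∈ R
  | _, hidden A _ rest => (∀ i j, A i j ∈ R) ∧ rest.WeightsIn R

/-- The network, with one output, computes the function `f` exactly. -/
def Represents {n : ℕ} (net : ReLUNetwork 1 n) (f : (Fin n → ℝ) → ℝ) : Prop :=
  ∀ x, net.eval x 0 = f x

end ReLUNetwork

/-- The `N`-ary fractions `z / N ^ t`, as real numbers. -/
def naryFractions (N : ℕ) : Set ℝ :=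
  {r | ∃ (z : ℤ) (t : ℕ), r = (z : ℝ) / (N : ℝ) ^ t}

/-- The function `max {0, x₁, …, xₙ}`. -/
noncomputable def maxPool (n : ℕ) (x : Fin n → ℝ) : ℝ :=
  Finset.univ.sup' Finset.univ_nonempty (Fin.cons 0 x : Fin (n + 1) → ℝ)

/-! For a prime `p` not dividing `N`, a network with `k` hidden layers computing the maximum forces
`n < p ^ k`; some such `p` has `log p = O(log log N)`, which gives the bound.

Biases can be dropped because the maximum is positively homogeneous. Up to a power of `N`, every
neuron is then a difference of support functions of lattice polytopes. Minkowski sum makes these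
polytopes multiply in a ring of characteristic `p`, where elements are identified if lattice point
counts mod `p` cannot separate them. Inclusion–exclusion for lattice points gives `(h - a) * (h - b)
= 0` for the classes `a`, `b` of two polytopes and `h` of the hull of their union
(`polytopeClass_union`). By Frobenius, each ReLU layer costs at most one factor `p` in the
multiplicative order (`pow_eq_one_of_sub_mul_sub_eq_zero`).

The simplex class `d` satisfies `(d - 1) ^ n ≠ 0`, since the `n`-th difference of its Ehrhart
polynomial is `1`. A network would give `d ^ (N ^ s * p ^ k) = 1`. As `d` has `p`-power order and `p
∤ N`, this yields `(d - 1) ^ p ^ k = 0`, hence `n < p ^ k`. -/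

/-! ### Small primes not dividing `N` -/

/-- Primes not dividing `N` show up at most polynomially late in `log N`. -/
theorem exists_prime_not_dvd_sqrt_le {N : ℕ} (hN : 3 ≤ N) :
    ∃ p : ℕ, p.Prime ∧ ¬ p ∣ N ∧ √(p : ℝ) ≤ 2 + 5 * Real.log N := by
  have hex : ∃ p : ℕ, p.Prime ∧ ¬ p ∣ N := by
    obtain ⟨p, hp, hpp⟩ := Nat.exists_infinite_primes (N + 1)
    exact ⟨p, hpp, fun h => by have := Nat.le_of_dvd (by omega) h; omega⟩
  classical
  obtain ⟨hp, hpN⟩ := Nat.find_spec hex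
  have hmin := fun m => Nat.find_min hex (m := m)
  set p := Nat.find hex
  refine ⟨p, hp, hpN, ?_⟩
  obtain ⟨m, hm⟩ : ∃ m, p = m + 1 := ⟨p - 1, by have := hp.pos; omega⟩
  set w := (Nat.primesLE m).card with hw
  -- Each prime power in the lcm of `1, …, m` is at most `m < p`.
  have hlcm : Nat.lcmUpto m ≤ p ^ w := by
    rw [Nat.lcmUpto_eq_prod_pow_log, hw, ← Finset.prod_const]
    refine Finset.prod_le_prod' fun q hq => ?_
    have hm0 : m ≠ 0 := by
      rintro rfl
      exact hp.ne_one hm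
    exact (Nat.pow_log_le_self q hm0).trans (by omega)
  -- By minimality of `p`, all primes up to `m = p - 1` divide `N`, and so does their product.
  have hwN : 2 ^ w ≤ N := by
    have hsub : Nat.primesLE m ⊆ N.primeFactors := by
      intro q hq
      have hqp := Nat.prime_of_mem_primesLE hq
      have hqm : q ≤ m := by
        exact Nat.le_of_mem_primesLE hq
      have := hmin q (by omega)
      rw [Nat.mem_primeFactors]
      refine ⟨hqp, ?_, by omega⟩
      by_contra h
      exact this ⟨hqp, h⟩
    calc 2 ^ w = ∏ _q ∈ Nat.primesLE m, 2 := by rw [Finset.prod_const]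
      _ ≤ ∏ q ∈ Nat.primesLE m, q :=
        Finset.prod_le_prod' fun q hq => (Nat.prime_of_mem_primesLE hq).two_le
      _ ≤ ∏ q ∈ N.primeFactors, q :=
        Finset.prod_le_prod_of_subset_of_one_le' hsub
          fun q hq _ => (Nat.prime_of_mem_primeFactors hq).one_le
      _ ≤ N := Nat.le_of_dvd (by omega) (Nat.prod_primeFactors_dvd N)
  have hpow : 2 ^ m ≤ p ^ (w + 1) := by
    calc 2 ^ m ≤ (m + 1) * Nat.lcmUpto m := Chebyshev.two_pow_le_mul_lcmUpto m
      _ ≤ p * p ^ w := by rw [hm] at *; gcongr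
      _ = p ^ (w + 1) := by ring
  have hl2 : (0.69 : ℝ) < Real.log 2 := by have := Real.log_two_gt_d9; linarith
  have hp2 : (2 : ℝ) ≤ p := by exact_mod_cast hp.two_le
  have h1 : (m : ℝ) * Real.log 2 ≤ (w + 1) * Real.log p := by
    have : ((2 : ℝ) ^ m) ≤ (p : ℝ) ^ (w + 1) := by exact_mod_cast hpow
    have := Real.log_le_log (by positivity) this
    rwa [Real.log_pow, Real.log_pow, Nat.cast_add, Nat.cast_one] at this
  have h2 : (w : ℝ) * Real.log 2 ≤ Real.log N := by
    have : ((2 : ℝ) ^ w) ≤ (N : ℝ) := by exact_mod_cast hwN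
    have := Real.log_le_log (by positivity) this
    rwa [Real.log_pow] at this
  have hmr : (m : ℝ) = p - 1 := by rw [hm]; push_cast; ring
  set s := √(p : ℝ) with hs
  have hss : s * s = p := Real.mul_self_sqrt (by positivity)
  have hs1 : 1 < s := by
    rw [hs]; exact Real.lt_sqrt_of_sq_lt (by linarith)
  have h3 : Real.log p ≤ 2 * (s - 1) := by
    have : Real.log s ≤ s - 1 := Real.log_le_sub_one_of_pos (by linarith)
    rw [← hss, Real.log_mul (by linarith) (by linarith)]
    linarith
  -- Bounding `log p` by `2 * (s - 1)` lets `s - 1` cancel against `p - 1 = (s - 1) * (s + 1)`.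
  have h4 : (s - 1) * ((s + 1) * Real.log 2) ≤ (s - 1) * (2 * (w + 1)) := by
    calc (s - 1) * ((s + 1) * Real.log 2) = (m : ℝ) * Real.log 2 := by rw [hmr, ← hss]; ring
      _ ≤ (w + 1) * Real.log p := h1
      _ ≤ (w + 1) * (2 * (s - 1)) := by gcongr
      _ = _ := by ring
  have h5 := le_of_mul_le_mul_left h4 (by linarith)
  have hw0 : (0 : ℝ) ≤ w := by positivity
  have h6 : (s + 1) * 0.69 ≤ 2 * (w + 1) := le_trans (by gcongr) h5
  have h7 : (w : ℝ) * 0.69 ≤ Real.log N := le_trans (by gcongr) h2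
  linarith

theorem log_three_gt_one : 1 < Real.log 3 := by
  rw [Real.lt_log_iff_exp_lt (by norm_num)]
  linarith [Real.exp_one_lt_d9]

theorem exists_prime_not_dvd_log_le :
    ∃ c : ℝ, 0 < c ∧ ∀ N : ℕ, 3 ≤ N →
      ∃ p : ℕ, p.Prime ∧ ¬ p ∣ N ∧ Real.log p ≤ c * Real.log (Real.log N) := by
  have h3 := Real.log_pos log_three_gt_one
  -- From `√p ≤ 2 + 5 log N ≤ 7 log N`; the additive `log 7` is absorbed using `log log N ≥ log log
  -- 3 > 0`.
  refine ⟨2 * (1 + Real.log 7 / Real.log (Real.log 3)), ?_, fun N hN => ?_⟩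
  · have : 0 < Real.log 7 := Real.log_pos (by norm_num)
    positivity
  obtain ⟨p, hp, hpN, hle⟩ := exists_prime_not_dvd_sqrt_le hN
  refine ⟨p, hp, hpN, ?_⟩
  have hx : Real.log 3 ≤ Real.log N := Real.log_le_log (by norm_num) (by exact_mod_cast hN)
  set x := Real.log N
  have hx1 : 1 < x := log_three_gt_one.trans_le hx
  have hp2 : (2 : ℝ) ≤ p := by exact_mod_cast hp.two_le
  have hs : √(p : ℝ) ≤ 7 * x := by linarith
  have h1 : Real.log p ≤ 2 * Real.log (7 * x) := by
    have := Real.log_le_log (Real.sqrt_pos.2 (by linarith)) hs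
    rw [Real.log_sqrt (by linarith)] at this
    linarith
  have h2 : Real.log (Real.log 3) ≤ Real.log x :=
    Real.log_le_log (by linarith [log_three_gt_one]) hx
  have h7 : 0 < Real.log 7 := Real.log_pos (by norm_num)
  have h4 : Real.log 7 ≤ Real.log 7 / Real.log (Real.log 3) * Real.log x := by
    rw [div_mul_eq_mul_div, le_div_iff₀ h3]
    gcongr
  rw [Real.log_mul (by norm_num) (by linarith)] at h1
  linarith

open scoped Pointwise

/-! ### Minkowski sums with a convex join -/

section ConvexJoin

variable {E : Type*} [AddCommGroup E] [Module ℝ E] {A B C : Set E}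

/-- Two points of the join carry total weight 2 on `A` and `B`, so one of these sets has weight at
least 1 and a full point of it splits off. -/
theorem Convex.convexJoin_add_convexJoin_add (hA : Convex ℝ A) (hB : Convex ℝ B)
    (hA₀ : A.Nonempty) (hB₀ : B.Nonempty) :
    convexJoin ℝ A B + convexJoin ℝ A B + C =
      (convexJoin ℝ A B + A + C) ∪ (convexJoin ℝ A B + B + C) := by
  rw [← Set.union_add]
  congr 1
  refine subset_antisymm ?_ (Set.union_subset (Set.add_subset_add_left ?_)
    (Set.add_subset_add_left ?_))
  · rintro _ ⟨x, hx, y, hy, rfl⟩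
    obtain ⟨a₁, ha₁, b₁, hb₁, s₁, t₁, hs₁, ht₁, h₁, rfl⟩ := mem_convexJoin.1 hx
    obtain ⟨a₂, ha₂, b₂, hb₂, s₂, t₂, hs₂, ht₂, h₂, rfl⟩ := mem_convexJoin.1 hy
    obtain ⟨a, ha, hae⟩ := hA.exists_mem_add_smul_eq ha₁ ha₂ hs₁ hs₂
    obtain ⟨b, hb, hbe⟩ := hB.exists_mem_add_smul_eq hb₁ hb₂ ht₁ ht₂
    have hsum : s₁ • a₁ + t₁ • b₁ + (s₂ • a₂ + t₂ • b₂) = (s₁ + s₂) • a + (t₁ + t₂) • b := by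
      rw [hae, hbe]; abel
    beta_reduce
    rw [hsum]
    rcases le_total 1 (s₁ + s₂) with h | h
    · left
      refine ⟨(s₁ + s₂ - 1) • a + (t₁ + t₂) • b, mem_convexJoin.2 ⟨a, ha, b, hb, s₁ + s₂ - 1,
        t₁ + t₂, by linarith, by linarith, by linarith, rfl⟩, a, ha, ?_⟩
      beta_reduce
      module
    · right
      refine ⟨(s₁ + s₂) • a + (t₁ + t₂ - 1) • b, mem_convexJoin.2 ⟨a, ha, b, hb, s₁ + s₂,
        t₁ + t₂ - 1, by linarith, by linarith, by linarith, rfl⟩, b, hb, ?_⟩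
      beta_reduce
      module
  · exact subset_convexJoin_left hB₀
  · exact subset_convexJoin_right hA₀

/-- One representation of a common point has weight at least 1 on `A`, the other at most 1; a
suitable convex combination has weight exactly 1 on each of `A` and `B`. -/
theorem Convex.convexJoin_add_inter_convexJoin_add (hA : Convex ℝ A) (hB : Convex ℝ B)
    (hC : Convex ℝ C) (hA₀ : A.Nonempty) (hB₀ : B.Nonempty) :
    (convexJoin ℝ A B + A + C) ∩ (convexJoin ℝ A B + B + C) = A + B + C := by
  refine subset_antisymm ?_ (Set.subset_inter ?_ ?_)
  · rintro x ⟨⟨_, ⟨e, he, a, ha, rfl⟩, c, hc, hx⟩, ⟨_, ⟨e', he', b, hb, rfl⟩, c', hc', hx'⟩⟩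
    obtain ⟨a₁, ha₁, b₁, hb₁, s, t, hs, ht, h₁, rfl⟩ := mem_convexJoin.1 he
    obtain ⟨a₂, ha₂, b₂, hb₂, s', t', hs', ht', h₂, rfl⟩ := mem_convexJoin.1 he'
    beta_reduce at hx hx'
    have hd : 0 < 1 + s - s' ∨ (s = 0 ∧ s' = 1) := by
      by_cases h : 0 < 1 + s - s'
      · exact Or.inl h
      · exact Or.inr ⟨by linarith, by linarith⟩
    -- When `s = 0` and `s' = 1` the general formula divides by zero, but the first representation
    -- is already balanced.
    obtain ⟨l, m, hl, hm, hlm, hw⟩ : ∃ l m : ℝ, 0 ≤ l ∧ 0 ≤ m ∧ l + m = 1 ∧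
        l * (1 + s) + m * s' = 1 := by
      rcases hd with hd | ⟨rfl, rfl⟩
      · refine ⟨(1 - s') / (1 + s - s'), s / (1 + s - s'), div_nonneg (by linarith) hd.le,
          div_nonneg hs hd.le, ?_, ?_⟩ <;> field_simp <;> ring
      · exact ⟨1, 0, by norm_num, le_rfl, by norm_num, by norm_num⟩
    obtain ⟨α, hα, hαe⟩ := hA.exists_mem_add_smul_eq ha₁ ha (mul_nonneg hl hs) hl
    obtain ⟨α', hα', hαe'⟩ := hA.exists_mem_add_smul_eq hα ha₂
      (add_nonneg (mul_nonneg hl hs) hl) (mul_nonneg hm hs')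
    obtain ⟨β, hβ, hβe⟩ := hB.exists_mem_add_smul_eq hb₂ hb (mul_nonneg hm ht') hm
    obtain ⟨β', hβ', hβe'⟩ := hB.exists_mem_add_smul_eq hβ hb₁
      (add_nonneg (mul_nonneg hm ht') hm) (mul_nonneg hl ht)
    have e1 : l * s + l + m * s' = 1 := by linarith
    have e2 : m * t' + m + l * t = 1 := by
      have : t = 1 - s := by linarith
      have : t' = 1 - s' := by linarith
      subst_vars
      linarith
    rw [e1, one_smul, hαe] at hαe'
    rw [e2, one_smul, hβe] at hβe'
    refine ⟨α' + β', ⟨α', hα', β', hβ', rfl⟩, l • c + m • c', hC hc hc' hl hm hlm, ?_⟩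
    beta_reduce
    have : x = l • x + m • x := by rw [← add_smul, hlm, one_smul]
    rw [this]
    nth_rewrite 1 [← hx]
    rw [← hx', hαe', hβe']
    module
  · refine Set.add_subset_add_right ?_
    rw [add_comm A B]
    exact Set.add_subset_add_right (subset_convexJoin_right hA₀)
  · exact Set.add_subset_add_right (Set.add_subset_add_right (subset_convexJoin_left hB₀))

end ConvexJoin

/-! ### Counting lattice points -/

section LatticePolytope

variable {n : ℕ}

/-- The inclusion of the lattice `ℤⁿ` into `ℝⁿ`. -/
def latticeEmb (n : ℕ) : (Fin n → ℤ) →+ (Fin n → ℝ) where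
  toFun v i := v i
  map_zero' := by ext; simp
  map_add' _ _ := by ext; simp

@[simp] theorem latticeEmb_apply (v : Fin n → ℤ) (i : Fin n) : latticeEmb n v i = v i := rfl

/-- The lattice polytope spanned by a finite set of lattice points. -/
def polytope (S : Finset (Fin n → ℤ)) : Set (Fin n → ℝ) :=
  convexHull ℝ (latticeEmb n '' S)

theorem convex_polytope (S : Finset (Fin n → ℤ)) : Convex ℝ (polytope S) :=
  convex_convexHull ℝ _

theorem isCompact_polytope (S : Finset (Fin n → ℤ)) : IsCompact (polytope S) :=
  (S.finite_toSet.image _).isCompact_convexHull ℝ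

theorem polytope_nonempty {S : Finset (Fin n → ℤ)} (hS : S.Nonempty) : (polytope S).Nonempty :=
  convexHull_nonempty_iff.2 (hS.to_set.image _)

theorem polytope_add (S T : Finset (Fin n → ℤ)) :
    polytope (S + T) = polytope S + polytope T := by
  rw [polytope, Finset.coe_add, Set.image_add, convexHull_add]; rfl

theorem polytope_union {S T : Finset (Fin n → ℤ)} (hS : S.Nonempty) (hT : T.Nonempty) :
    polytope (S ∪ T) = convexJoin ℝ (polytope S) (polytope T) := by
  rw [polytope, Finset.coe_union, Set.image_union,
    convexHull_union (hS.to_set.image _) (hT.to_set.image _)]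
  rfl

/-- The lattice points of a lattice polytope. -/
def latticePoints (S : Finset (Fin n → ℤ)) : Set (Fin n → ℤ) :=
  latticeEmb n ⁻¹' polytope S

theorem finite_latticePoints (S : Finset (Fin n → ℤ)) : (latticePoints S).Finite := by
  obtain ⟨R, hR⟩ := (isCompact_polytope S).isBounded.exists_norm_le
  refine (Set.finite_Icc (fun _ => -⌈R⌉ : Fin n → ℤ) (fun _ => ⌈R⌉)).subset fun v hv => ?_
  have h : ∀ i, |v i| ≤ ⌈R⌉ := fun i => by
    have h1 : |(v i : ℝ)| ≤ R := (norm_le_pi_norm (latticeEmb n v) i).trans (hR _ hv)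
    have h2 : (|v i| : ℝ) ≤ (⌈R⌉ : ℤ) := h1.trans (Int.le_ceil R)
    exact_mod_cast h2
  exact ⟨fun i => (abs_le.1 (h i)).1, fun i => (abs_le.1 (h i)).2⟩

/-- The number of lattice points of a lattice polytope. -/
noncomputable def latticeCount (S : Finset (Fin n → ℤ)) : ℕ := (latticePoints S).ncard

/-- Inclusion–exclusion applied to the two convex-join identities. -/
theorem latticeCount_union_add {P Q : Finset (Fin n → ℤ)} (hP : P.Nonempty) (hQ : Q.Nonempty)
    (S : Finset (Fin n → ℤ)) :
    latticeCount ((P ∪ Q) + (P ∪ Q) + S) + latticeCount (P + Q + S) =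
      latticeCount ((P ∪ Q) + P + S) + latticeCount ((P ∪ Q) + Q + S) := by
  have h1 : latticePoints ((P ∪ Q) + (P ∪ Q) + S) =
      latticePoints ((P ∪ Q) + P + S) ∪ latticePoints ((P ∪ Q) + Q + S) := by
    simp only [latticePoints, polytope_add, polytope_union hP hQ, ← Set.preimage_union]
    rw [(convex_polytope P).convexJoin_add_convexJoin_add (convex_polytope Q)
      (polytope_nonempty hP) (polytope_nonempty hQ)]
  have h2 : latticePoints (P + Q + S) =
      latticePoints ((P ∪ Q) + P + S) ∩ latticePoints ((P ∪ Q) + Q + S) := by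
    simp only [latticePoints, polytope_add, polytope_union hP hQ, ← Set.preimage_inter]
    rw [(convex_polytope P).convexJoin_add_inter_convexJoin_add (convex_polytope Q)
      (convex_polytope S) (polytope_nonempty hP) (polytope_nonempty hQ)]
  rw [latticeCount, latticeCount, h1, h2]
  exact Set.ncard_union_add_ncard_inter _ _ (finite_latticePoints _) (finite_latticePoints _)

theorem latticeCount_singleton_add (v : Fin n → ℤ) (S : Finset (Fin n → ℤ)) :
    latticeCount ({v} + S) = latticeCount S := by
  have : latticePoints ({v} + S) = (fun w => v + w) '' latticePoints S := by
    ext w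
    simp only [latticePoints, polytope_add, Set.mem_preimage, Set.image_add_left]
    simp [polytope, ← map_neg, ← map_add]
  rw [latticeCount, this, Set.ncard_image_of_injective _ (add_right_injective v), latticeCount]

theorem latticeCount_zero : latticeCount (0 : Finset (Fin n → ℤ)) = 1 := by
  have : latticePoints (0 : Finset (Fin n → ℤ)) = {0} := by
    ext w
    simp only [latticePoints, polytope, Set.mem_preimage, Finset.coe_zero, Set.image_zero]
    simp [funext_iff]
  rw [latticeCount, this, Set.ncard_singleton]

/-- The vertices `0, e₁, …, eₙ` of the standard simplex. -/
def stdVertices (n : ℕ) : Finset (Fin n → ℤ) :=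
  insert 0 (Finset.univ.image fun i => Pi.single i 1)

theorem single_mem_stdVertices (i : Fin n) : Pi.single i 1 ∈ stdVertices n := by
  simp [stdVertices]

theorem zero_mem_stdVertices : 0 ∈ stdVertices n := by simp [stdVertices]

theorem mem_nsmul_stdVertices (j : ℕ) (v : Fin n → ℤ) (hv : 0 ≤ v) (hj : ∑ i, v i ≤ j) :
    v ∈ j • stdVertices n := by
  induction j generalizing v with
  | zero =>
    have : v = 0 := by
      ext i
      refine le_antisymm ?_ (hv i)
      exact (Finset.single_le_sum (fun i _ => hv i) (Finset.mem_univ i)).trans (by simpa using hj)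
    simp [this]
  | succ j ih =>
    rw [succ_nsmul]
    by_cases h : ∃ i, 0 < v i
    · obtain ⟨i, hi⟩ := h
      rw [Finset.mem_add]
      refine ⟨v - Pi.single i 1, ih _ ?_ ?_, Pi.single i 1, single_mem_stdVertices i, by simp⟩
      · intro k
        by_cases hk : k = i
        · subst hk; simp; omega
        · simpa [hk] using hv k
      · simp only [Pi.sub_apply, Finset.sum_sub_distrib, Finset.sum_pi_single']
        push_cast at hj
        simp
        linarith
    · push Not at h
      have : v = 0 := le_antisymm h hv
      subst this
      exact Finset.mem_add.2 ⟨0, ih 0 le_rfl (by simp), 0, zero_mem_stdVertices, by simp⟩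

theorem mem_latticePoints_nsmul_stdVertices (j : ℕ) (v : Fin n → ℤ) :
    v ∈ latticePoints (j • stdVertices n) ↔ 0 ≤ v ∧ ∑ i, v i ≤ j := by
  constructor
  · intro hv
    have hle : ∀ w ∈ j • stdVertices n, 0 ≤ w ∧ ∑ i, w i ≤ j := by
      clear hv
      induction j with
      | zero => simp
      | succ j ih =>
        intro w hw
        rw [succ_nsmul, Finset.mem_add] at hw
        obtain ⟨a, ha, b, hb, rfl⟩ := hw
        obtain ⟨h1, h2⟩ := ih a ha
        have hb' : 0 ≤ b ∧ ∑ i, b i ≤ 1 := by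
          simp only [stdVertices, Finset.mem_insert, Finset.mem_image, Finset.mem_univ,
            true_and] at hb
          rcases hb with rfl | ⟨i, rfl⟩
          · simp
          · exact ⟨Pi.single_nonneg.2 zero_le_one, by simp⟩
        refine ⟨add_nonneg h1 hb'.1, ?_⟩
        simp only [Pi.add_apply, Finset.sum_add_distrib]
        push_cast
        linarith [hb'.2]
    have hsub : polytope (j • stdVertices n) ⊆ {x | 0 ≤ x ∧ ∑ i, x i ≤ (j : ℝ)} := by
      refine convexHull_min ?_ ?_
      · rintro _ ⟨w, hw, rfl⟩
        obtain ⟨h1, h2⟩ := hle w hw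
        refine ⟨fun i => by simpa using h1 i, ?_⟩
        simp only [latticeEmb_apply]
        exact_mod_cast h2
      · rintro x ⟨hx, hx'⟩ y ⟨hy, hy'⟩ a b ha hb hab
        refine ⟨add_nonneg (smul_nonneg ha hx) (smul_nonneg hb hy), ?_⟩
        simp only [Pi.add_apply, Pi.smul_apply, smul_eq_mul, Finset.sum_add_distrib,
          ← Finset.mul_sum]
        calc a * ∑ i, x i + b * ∑ i, y i ≤ a * j + b * j := by gcongr
          _ = j := by rw [← add_mul, hab, one_mul]
    obtain ⟨h1, h2⟩ := hsub hv
    refine ⟨fun i => by simpa using h1 i, ?_⟩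
    simp only [latticeEmb_apply] at h2
    exact_mod_cast h2
  · rintro ⟨h1, h2⟩
    exact subset_convexHull ℝ _ ⟨v, mem_nsmul_stdVertices j v h1 h2, rfl⟩

/-- A slack coordinate turns the lattice points into compositions of `j` into `n + 1` nonnegative
parts. -/
theorem latticeCount_nsmul_stdVertices (n j : ℕ) :
    latticeCount (j • stdVertices n) = (n + j).choose n := by
  have hcard := Finset.card_finsuppAntidiag_nat_eq_choose
    (s := (Finset.univ : Finset (Fin (n + 1)))) j
  have : latticePoints (j • stdVertices n) =
      (fun (f : Fin (n + 1) →₀ ℕ) (i : Fin n) => (f i.succ : ℤ)) ''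
        (Finset.univ : Finset (Fin (n + 1))).finsuppAntidiag j := by
    ext v
    rw [mem_latticePoints_nsmul_stdVertices]
    constructor
    · rintro ⟨h1, h2⟩
      lift v to Fin n → ℕ using h1
      have h3 : ∑ i, v i ≤ j := by beta_reduce at h2; exact_mod_cast h2
      refine ⟨Finsupp.equivFunOnFinite.symm (Fin.cons (j - ∑ i, v i) v), ?_, ?_⟩
      · simp [Finset.mem_finsuppAntidiag, Fin.sum_univ_succ]
        omega
      · ext i; simp
    · rintro ⟨f, hf, rfl⟩
      simp [Finset.mem_finsuppAntidiag, Fin.sum_univ_succ] at hf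
      refine ⟨fun i => by simp, ?_⟩
      beta_reduce
      rw [← hf]
      push_cast
      linarith [(f 0).zero_le]
  rw [latticeCount, this, Set.InjOn.ncard_image, Set.ncard_coe_finset, hcard]
  · simp
    rw [Nat.choose_symm_add]
  · intro f hf g hg hfg
    simp only [Finset.mem_coe, Finset.mem_finsuppAntidiag,
      Fin.sum_univ_succ] at hf hg
    have h : ∀ i : Fin n, f i.succ = g i.succ := fun i => by
      have := congrFun hfg i
      beta_reduce at this
      exact_mod_cast this
    ext i
    refine Fin.cases ?_ h i
    have := hf.1.trans hg.1.symm
    simp only [h] at this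
    omega

end LatticePolytope

/-! ### The polytope ring modulo `p` -/

section PolytopeRing

variable {n : ℕ} {p : ℕ}

/-- The linear extension, modulo `p`, of the number of lattice points to formal combinations of
lattice polytopes. -/
noncomputable def countFunctional (p n : ℕ) :
    AddMonoidAlgebra (ZMod p) (Finset (Fin n → ℤ)) →ₗ[ZMod p] ZMod p :=
  Finsupp.linearCombination (ZMod p) (fun S => (latticeCount S : ZMod p)) ∘ₗ
    (AddMonoidAlgebra.coeffLinearEquiv (ZMod p)).toLinearMap

@[simp] theorem countFunctional_single (S : Finset (Fin n → ℤ)) :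
    countFunctional p n (AddMonoidAlgebra.single S 1) = latticeCount S := by
  simp [countFunctional, AddMonoidAlgebra.coeffLinearEquiv]

/-- The radical of the bilinear form `(a, b) ↦ countFunctional p n (a * b)`. -/
noncomputable def countRadical (p n : ℕ) :
    Ideal (AddMonoidAlgebra (ZMod p) (Finset (Fin n → ℤ))) where
  carrier := {a | ∀ b, countFunctional p n (a * b) = 0}
  zero_mem' b := by simp
  add_mem' ha hb c := by rw [add_mul, map_add, ha, hb, add_zero]
  smul_mem' c a ha b := by rw [smul_eq_mul, mul_comm c a, mul_assoc, ha]

theorem mem_countRadical_iff {a : AddMonoidAlgebra (ZMod p) (Finset (Fin n → ℤ))} :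
    a ∈ countRadical p n ↔
      ∀ S, countFunctional p n (a * AddMonoidAlgebra.single S 1) = 0 := by
  refine ⟨fun h S => h _, fun h b => ?_⟩
  induction b using AddMonoidAlgebra.induction_on with
  | of S => exact h S
  | add x y hx hy => rw [mul_add, map_add, hx, hy, add_zero]
  | smul r x hx => rw [mul_smul_comm, map_smul, hx, smul_zero]

/-- The ring of lattice polytopes modulo `p`: Minkowski sum is multiplication, and elements are
identified when all their products have the same number of lattice points modulo `p`. -/
abbrev PolytopeRing (p n : ℕ) : Type :=
  AddMonoidAlgebra (ZMod p) (Finset (Fin n → ℤ)) ⧸ countRadical p n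

/-- The class of a lattice polytope. -/
noncomputable def polytopeClass (p : ℕ) (S : Finset (Fin n → ℤ)) : PolytopeRing p n :=
  Ideal.Quotient.mk _ (AddMonoidAlgebra.single S 1)

theorem polytopeClass_add (S T : Finset (Fin n → ℤ)) :
    polytopeClass p (S + T) = polytopeClass p S * polytopeClass p T := by
  rw [polytopeClass, polytopeClass, polytopeClass, ← map_mul, AddMonoidAlgebra.single_mul_single,
    one_mul]

theorem polytopeClass_zero : polytopeClass p (0 : Finset (Fin n → ℤ)) = 1 := by
  rw [polytopeClass, ← AddMonoidAlgebra.one_def, map_one]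

theorem polytopeClass_nsmul (j : ℕ) (S : Finset (Fin n → ℤ)) :
    polytopeClass p (j • S) = polytopeClass p S ^ j := by
  induction j with
  | zero => rw [zero_nsmul, polytopeClass_zero, pow_zero]
  | succ j ih => rw [succ_nsmul, polytopeClass_add, ih, pow_succ]

theorem polytopeClass_singleton (v : Fin n → ℤ) : polytopeClass p {v} = 1 := by
  rw [← polytopeClass_zero, polytopeClass, polytopeClass, Ideal.Quotient.eq,
    mem_countRadical_iff]
  intro S
  rw [sub_mul, map_sub, AddMonoidAlgebra.single_mul_single, AddMonoidAlgebra.single_mul_single,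
    one_mul, countFunctional_single, countFunctional_single, latticeCount_singleton_add, zero_add,
    sub_self]

theorem polytopeClass_eq_of_polytope_eq {S T : Finset (Fin n → ℤ)}
    (h : polytope S = polytope T) : polytopeClass p S = polytopeClass p T := by
  rw [polytopeClass, polytopeClass, Ideal.Quotient.eq, mem_countRadical_iff]
  intro U
  have : latticeCount (S + U) = latticeCount (T + U) := by
    simp only [latticeCount, latticePoints, polytope_add, h]
  rw [sub_mul, map_sub, AddMonoidAlgebra.single_mul_single, AddMonoidAlgebra.single_mul_single,
    one_mul, countFunctional_single, countFunctional_single, this, sub_self]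

theorem polytopeClass_union {P Q : Finset (Fin n → ℤ)} (hP : P.Nonempty) (hQ : Q.Nonempty) :
    (polytopeClass p (P ∪ Q) - polytopeClass p P) *
      (polytopeClass p (P ∪ Q) - polytopeClass p Q) = 0 := by
  simp only [polytopeClass]
  rw [← map_sub, ← map_sub, ← map_mul, Ideal.Quotient.eq_zero_iff_mem, mem_countRadical_iff]
  intro S
  have h := congrArg (Nat.cast : ℕ → ZMod p) (latticeCount_union_add hP hQ S)
  push_cast at h
  simp only [sub_mul, mul_sub, map_sub, AddMonoidAlgebra.single_mul_single, one_mul,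
    countFunctional_single]
  rw [add_comm P (P ∪ Q)]
  linear_combination h

instance [hp : Fact p.Prime] : CharP (PolytopeRing p n) p := by
  have : Nontrivial (PolytopeRing p n) := by
    refine Ideal.Quotient.nontrivial_iff.2 fun h => ?_
    have h1 : (1 : AddMonoidAlgebra (ZMod p) (Finset (Fin n → ℤ))) ∈ countRadical p n :=
      (Ideal.eq_top_iff_one _).1 h
    have h2 := h1 1
    rw [one_mul, AddMonoidAlgebra.one_def, countFunctional_single, latticeCount_zero] at h2
    simp at h2
  exact charP_of_injective_algebraMap (algebraMap (ZMod p) (PolytopeRing p n)).injective p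

/-- The relation gives `(h - b)² = (h - b)(a - b)`, so `(h - b) ^ (p ^ k + 1) = (h - b) * (a ^ p ^ k
- b ^ p ^ k) = 0`. Since `p ^ k + 1 ≤ p ^ (k + 1)`, Frobenius finishes. -/
theorem pow_eq_one_of_sub_mul_sub_eq_zero {R : Type*} [CommRing R] (p : ℕ) [hp : Fact p.Prime]
    [CharP R p] {h a b : R} {k : ℕ} (hab : (h - a) * (h - b) = 0) (ha : a ^ p ^ k = 1)
    (hb : b ^ p ^ k = 1) : h ^ p ^ (k + 1) = 1 := by
  have hsq : ∀ m : ℕ, (h - b) ^ (m + 1) = (h - b) * (a - b) ^ m := by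
    intro m
    induction m with
    | zero => simp
    | succ m ih =>
      rw [pow_succ, ih, pow_succ]
      linear_combination (a - b) ^ m * hab
  have hz : (h - b) ^ (p ^ k + 1) = 0 := by
    rw [hsq, sub_pow_char_pow, ha, hb, sub_self, mul_zero]
  have hle : p ^ k + 1 ≤ p ^ (k + 1) := Nat.pow_lt_pow_right hp.out.one_lt (Nat.lt_succ_self k)
  have hz' : (h - b) ^ p ^ (k + 1) = 0 := pow_eq_zero_of_le hle hz
  rw [sub_pow_char_pow, sub_eq_zero] at hz'
  rw [hz', pow_succ, pow_mul, hb, one_pow]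

theorem polytopeClass_union_pow [Fact p.Prime] {P Q : Finset (Fin n → ℤ)} (hP : P.Nonempty)
    (hQ : Q.Nonempty) {k : ℕ} (h₁ : polytopeClass p P ^ p ^ k = 1)
    (h₂ : polytopeClass p Q ^ p ^ k = 1) : polytopeClass p (P ∪ Q) ^ p ^ (k + 1) = 1 :=
  pow_eq_one_of_sub_mul_sub_eq_zero p (polytopeClass_union hP hQ) h₁ h₂

/-- Vertices are added one at a time. The size of `k` is irrelevant: a `p`-power order suffices to
cancel exponents prime to `p`. -/
theorem exists_polytopeClass_pow_eq_one [Fact p.Prime] {S : Finset (Fin n → ℤ)}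
    (hS : S.Nonempty) : ∃ k, polytopeClass p S ^ p ^ k = 1 := by
  induction hS using Finset.Nonempty.cons_induction with
  | singleton v => exact ⟨0, by rw [polytopeClass_singleton, one_pow]⟩
  | cons v S hv hS ih =>
    obtain ⟨k, hk⟩ := ih
    rw [Finset.cons_eq_insert, Finset.insert_eq]
    exact ⟨k + 1, polytopeClass_union_pow (Finset.singleton_nonempty v) hS
      (by rw [polytopeClass_singleton, one_pow]) hk⟩

/-- The `n`-th forward difference of `x ↦ x.choose n`, taken at `n`. -/
theorem sum_neg_one_pow_mul_choose_mul_choose (n : ℕ) :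
    ∑ j ∈ Finset.range (n + 1), ((-1 : ℤ) ^ (n - j) * n.choose j) * ((n + j).choose n : ℤ) = 1 := by
  have h1 := fwdDiff_iter_eq_sum_shift (1 : ℕ) (fun x => (x.choose n : ℤ)) n n
  have h2 := fwdDiff_iter_choose 0 n
  simp only [add_zero, Nat.choose_zero_right, Nat.cast_one] at h2
  rw [h2] at h1
  simpa using h1.symm

/-- The counting functional sends the binomial expansion to the `n`-th difference of the Ehrhart
polynomial, which is `1`. -/
theorem polytopeClass_stdVertices_sub_one_pow_ne_zero [Fact p.Prime] :
    (polytopeClass p (stdVertices n) - 1) ^ n ≠ 0 := by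
  intro h
  rw [polytopeClass, ← map_one (Ideal.Quotient.mk _), ← map_sub, ← map_pow,
    Ideal.Quotient.eq_zero_iff_mem] at h
  have h1 := h 1
  rw [mul_one, sub_eq_add_neg, add_pow, map_sum] at h1
  have h2 : ∀ j ∈ Finset.range (n + 1), countFunctional p n
      (AddMonoidAlgebra.single (stdVertices n) (1 : ZMod p) ^ j * (-1) ^ (n - j) *
        (n.choose j : AddMonoidAlgebra (ZMod p) (Finset (Fin n → ℤ)))) =
      ((((-1 : ℤ) ^ (n - j) * n.choose j) * ((n + j).choose n : ℤ) : ℤ) : ZMod p) := by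
    intro j _
    have : AddMonoidAlgebra.single (stdVertices n) (1 : ZMod p) ^ j * (-1) ^ (n - j) *
        (n.choose j) = ((-1 : ℤ) ^ (n - j) * n.choose j) •
          AddMonoidAlgebra.single (j • stdVertices n) (1 : ZMod p) := by
      rw [AddMonoidAlgebra.single_pow, one_pow, zsmul_eq_mul]
      push_cast
      ring
    rw [this, map_zsmul, countFunctional_single, latticeCount_nsmul_stdVertices, zsmul_eq_mul]
    push_cast
    ring
  rw [Finset.sum_congr rfl h2, ← Int.cast_sum, sum_neg_one_pow_mul_choose_mul_choose] at h1
  simp at h1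

end PolytopeRing

/-! ### Support functions -/

section SupportFunction

variable {n : ℕ}

/-- `f` is the support function of the lattice polytope spanned by `S`. -/
def IsSupportFunction (S : Finset (Fin n → ℤ)) (f : (Fin n → ℝ) → ℝ) : Prop :=
  ∀ x, IsGreatest ((fun v : Fin n → ℤ => ∑ i, (v i : ℝ) * x i) '' S) (f x)

variable {S T : Finset (Fin n → ℤ)} {f g : (Fin n → ℝ) → ℝ}

theorem IsSupportFunction.nonempty (hf : IsSupportFunction S f) : S.Nonempty :=
  Finset.coe_nonempty.1 (Set.image_nonempty.1 (hf 0).nonempty)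

theorem isSupportFunction_singleton (v : Fin n → ℤ) :
    IsSupportFunction {v} (fun x => ∑ i, (v i : ℝ) * x i) := by
  intro x
  simp

theorem IsSupportFunction.union (hf : IsSupportFunction S f) (hg : IsSupportFunction T g) :
    IsSupportFunction (S ∪ T) (fun x => max (f x) (g x)) := by
  intro x
  rw [Finset.coe_union, Set.image_union]
  exact (hf x).union (hg x)

theorem IsSupportFunction.add (hf : IsSupportFunction S f) (hg : IsSupportFunction T g) :
    IsSupportFunction (S + T) (f + g) := by
  intro x
  obtain ⟨⟨v, hv, hv'⟩, hf'⟩ := hf x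
  obtain ⟨⟨w, hw, hw'⟩, hg'⟩ := hg x
  refine ⟨⟨v + w, Finset.mem_coe.2 (Finset.add_mem_add hv hw), ?_⟩, ?_⟩
  · rw [Pi.add_apply, ← hv', ← hw']
    simp [add_mul, Finset.sum_add_distrib]
  · rintro _ ⟨u, hu, rfl⟩
    obtain ⟨a, ha, b, hb, rfl⟩ := Finset.mem_add.1 (Finset.mem_coe.1 hu)
    have h := add_le_add (hf' ⟨a, ha, rfl⟩) (hg' ⟨b, hb, rfl⟩)
    simpa [add_mul, Finset.sum_add_distrib] using h

theorem IsSupportFunction.nsmul (hf : IsSupportFunction S f) (j : ℕ) :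
    IsSupportFunction (j • S) (j • f) := by
  induction j with
  | zero =>
    intro x
    simp
  | succ j ih =>
    rw [succ_nsmul, succ_nsmul]
    exact ih.add hf

/-- A vertex outside the other polytope would be separated from it by a functional, at which the
support functions would differ. -/
theorem IsSupportFunction.polytope_subset (hf : IsSupportFunction S f)
    (hg : IsSupportFunction T f) : polytope S ⊆ polytope T := by
  refine convexHull_min ?_ (convex_polytope T)
  rintro _ ⟨v, hv, rfl⟩
  by_contra hvT
  obtain ⟨l, u, hlu, hul⟩ := geometric_hahn_banach_closed_point (convex_polytope T)
    (isCompact_polytope T).isClosed hvT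
  have hl : ∀ w : Fin n → ℤ, l (latticeEmb n w) = ∑ i, (w i : ℝ) * l (Pi.single i 1) := by
    intro w
    conv_lhs => rw [← Finset.univ_sum_single (latticeEmb n w)]
    rw [map_sum]
    refine Finset.sum_congr rfl fun i _ => ?_
    rw [← smul_eq_mul, ← map_smul, ← Pi.single_smul]
    simp
  obtain ⟨⟨w, hw, hw'⟩, -⟩ := hg fun i => l (Pi.single i 1)
  have h1 := (hf fun i => l (Pi.single i 1)).2 ⟨v, hv, rfl⟩
  beta_reduce at h1 hw'
  rw [← hw', ← hl, ← hl] at h1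
  have h2 := hlu _ (subset_convexHull ℝ _ ⟨w, hw, rfl⟩)
  linarith

theorem IsSupportFunction.polytopeClass_eq (p : ℕ) (hf : IsSupportFunction S f)
    (hg : IsSupportFunction T f) : polytopeClass p S = polytopeClass p T :=
  polytopeClass_eq_of_polytope_eq
    (subset_antisymm (hf.polytope_subset hg) (hg.polytope_subset hf))

theorem isSupportFunction_stdVertices : IsSupportFunction (stdVertices n) (maxPool n) := by
  intro x
  have himg : (fun v : Fin n → ℤ => ∑ i, (v i : ℝ) * x i) '' (stdVertices n) =
      Set.range (Fin.cons 0 x : Fin (n + 1) → ℝ) := by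
    rw [Fin.range_cons, stdVertices, Finset.coe_insert, Set.image_insert_eq]
    congr 1
    · simp
    · ext y
      simp [Pi.single_apply]
  rw [himg]
  refine ⟨?_, ?_⟩
  · obtain ⟨i, -, hi⟩ := Finset.exists_mem_eq_sup' (Finset.univ_nonempty)
      (Fin.cons 0 x : Fin (n + 1) → ℝ)
    exact ⟨i, hi.symm⟩
  · rintro _ ⟨i, rfl⟩
    exact Finset.le_sup' (Fin.cons 0 x : Fin (n + 1) → ℝ) (Finset.mem_univ i)

end SupportFunction

/-! ### Differences of support functions -/

section Representable

variable {n : ℕ} {p N : ℕ}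

/-- Up to a power of `N`, the function `g` is a difference of support functions of lattice
polytopes whose classes modulo `p` have order dividing `p ^ k`. -/
def PolytopeRepresentable (p N k : ℕ) (g : (Fin n → ℝ) → ℝ) : Prop :=
  ∃ (s : ℕ) (P Q : Finset (Fin n → ℤ)) (f₁ f₂ : (Fin n → ℝ) → ℝ),
    IsSupportFunction P f₁ ∧ IsSupportFunction Q f₂ ∧
      polytopeClass p P ^ p ^ k = 1 ∧ polytopeClass p Q ^ p ^ k = 1 ∧
        ∀ x, (N : ℝ) ^ s * g x = f₁ x - f₂ x

variable {k : ℕ} {g g' : (Fin n → ℝ) → ℝ}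

theorem isSupportFunction_zero : IsSupportFunction (0 : Finset (Fin n → ℤ)) (fun _ => 0) := by
  intro x
  simp

theorem PolytopeRepresentable.zero : PolytopeRepresentable p N k (fun _ : Fin n → ℝ => 0) :=
  ⟨0, 0, 0, _, _, isSupportFunction_zero, isSupportFunction_zero,
    by rw [polytopeClass_zero, one_pow], by rw [polytopeClass_zero, one_pow], by simp⟩

theorem PolytopeRepresentable.coord (i : Fin n) :
    PolytopeRepresentable p N 0 (fun x : Fin n → ℝ => x i) :=
  ⟨0, {Pi.single i 1}, 0, _, _, isSupportFunction_singleton _, isSupportFunction_zero,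
    by rw [polytopeClass_singleton, one_pow], by rw [polytopeClass_zero, one_pow],
    by simp [Pi.single_apply]⟩

theorem PolytopeRepresentable.add (hg : PolytopeRepresentable p N k g)
    (hg' : PolytopeRepresentable p N k g') :
    PolytopeRepresentable p N k (fun x => g x + g' x) := by
  obtain ⟨s, P, Q, f₁, f₂, hP, hQ, cP, cQ, h⟩ := hg
  obtain ⟨s', P', Q', f₁', f₂', hP', hQ', cP', cQ', h'⟩ := hg'
  refine ⟨s + s', N ^ s' • P + N ^ s • P', N ^ s' • Q + N ^ s • Q', _, _,
    (hP.nsmul _).add (hP'.nsmul _), (hQ.nsmul _).add (hQ'.nsmul _), ?_, ?_, fun x => ?_⟩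
  · rw [polytopeClass_add, polytopeClass_nsmul, polytopeClass_nsmul, mul_pow, pow_right_comm, cP,
      pow_right_comm, cP', one_pow, one_pow, one_mul]
  · rw [polytopeClass_add, polytopeClass_nsmul, polytopeClass_nsmul, mul_pow, pow_right_comm, cQ,
      pow_right_comm, cQ', one_pow, one_pow, one_mul]
  · simp only [Pi.add_apply, Pi.smul_apply]
    simp only [nsmul_eq_mul, Nat.cast_pow, pow_add]
    linear_combination (N : ℝ) ^ s' * h x + (N : ℝ) ^ s * h' x

theorem PolytopeRepresentable.const_mul (hN : N ≠ 0) (hg : PolytopeRepresentable p N k g) {r : ℝ}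
    (hr : r ∈ naryFractions N) : PolytopeRepresentable p N k (fun x => r * g x) := by
  obtain ⟨z, t, rfl⟩ := hr
  obtain ⟨s, P, Q, f₁, f₂, hP, hQ, cP, cQ, h⟩ := hg
  have hN' : (N : ℝ) ^ t ≠ 0 := pow_ne_zero _ (Nat.cast_ne_zero.2 hN)
  obtain ⟨m, rfl | rfl⟩ := z.eq_nat_or_neg
  · refine ⟨s + t, m • P, m • Q, _, _, hP.nsmul m, hQ.nsmul m, ?_, ?_, fun x => ?_⟩
    · rw [polytopeClass_nsmul, pow_right_comm, cP, one_pow]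
    · rw [polytopeClass_nsmul, pow_right_comm, cQ, one_pow]
    · simp only [Pi.smul_apply, nsmul_eq_mul, pow_add]
      field_simp
      push_cast
      linear_combination (m : ℝ) * h x
  · refine ⟨s + t, m • Q, m • P, _, _, hQ.nsmul m, hP.nsmul m, ?_, ?_, fun x => ?_⟩
    · rw [polytopeClass_nsmul, pow_right_comm, cQ, one_pow]
    · rw [polytopeClass_nsmul, pow_right_comm, cP, one_pow]
    · simp only [Pi.smul_apply, nsmul_eq_mul, pow_add]
      field_simp
      push_cast
      linear_combination -(m : ℝ) * h x

theorem PolytopeRepresentable.mulVec (hN : N ≠ 0) {l m : ℕ} {A : Matrix (Fin l) (Fin m) ℝ}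
    (hA : ∀ i j, A i j ∈ naryFractions N) {G : (Fin n → ℝ) → Fin m → ℝ}
    (hG : ∀ j, PolytopeRepresentable p N k (fun x => G x j)) (i : Fin l) :
    PolytopeRepresentable p N k (fun x => A.mulVec (G x) i) := by
  have : ∀ J : Finset (Fin m), PolytopeRepresentable p N k (fun x => ∑ j ∈ J, A i j * G x j) := by
    intro J
    induction J using Finset.cons_induction with
    | empty => simpa using PolytopeRepresentable.zero
    | cons j J hj ih =>
      simp only [Finset.sum_cons]
      exact ((hG j).const_mul hN (hA i j)).add ih
  exact this Finset.univ

/-- `max 0 (f₁ - f₂) = max f₁ f₂ - f₂`, and `max f₁ f₂` belongs to the hull of the union. -/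
theorem PolytopeRepresentable.relu [Fact p.Prime] (hg : PolytopeRepresentable p N k g) :
    PolytopeRepresentable p N (k + 1) (fun x => max 0 (g x)) := by
  obtain ⟨s, P, Q, f₁, f₂, hP, hQ, cP, cQ, h⟩ := hg
  refine ⟨s, P ∪ Q, Q, _, _, hP.union hQ, hQ,
    polytopeClass_union_pow hP.nonempty hQ.nonempty cP cQ, ?_, fun x => ?_⟩
  · rw [pow_succ, pow_mul, cQ, one_pow]
  · rw [mul_max_of_nonneg _ _ (by positivity), h, mul_zero, ← max_sub_sub_right, sub_self, max_comm]

/-- For `p ^ k ≤ n` and `p` not dividing `N`, the maximum of `n` variables and zero is not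
representable by polytopes whose classes have order dividing `p ^ k`. -/
theorem not_polytopeRepresentable_maxPool [hp : Fact p.Prime] (hpN : ¬ p ∣ N) (hk : p ^ k ≤ n) :
    ¬ PolytopeRepresentable p N k (maxPool n) := by
  rintro ⟨s, P, Q, f₁, f₂, hP, hQ, cP, cQ, h⟩
  have hΔ := (isSupportFunction_stdVertices (n := n)).nsmul (N ^ s)
  -- Moving `f₂` across makes both sides support functions, so the polytope classes can be compared.
  have hsum : N ^ s • maxPool n + f₂ = f₁ := by
    ext x
    simp only [Pi.add_apply, Pi.smul_apply]
    simp only [nsmul_eq_mul, Nat.cast_pow]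
    linear_combination h x
  have hcls := (hsum ▸ hΔ.add hQ).polytopeClass_eq p hP
  rw [polytopeClass_add, polytopeClass_nsmul] at hcls
  set d := polytopeClass p (stdVertices n)
  have h1 : d ^ (N ^ s * p ^ k) = 1 := by
    have := congrArg (· ^ p ^ k) hcls
    simpa only [mul_pow, cP, cQ, mul_one, ← pow_mul] using this
  obtain ⟨K, hK⟩ : ∃ K, d ^ p ^ K = 1 :=
    exists_polytopeClass_pow_eq_one ⟨0, zero_mem_stdVertices⟩
  have hcop : Nat.Coprime (p ^ K) (N ^ s) :=
    Nat.Coprime.pow _ _ ((Nat.Prime.coprime_iff_not_dvd hp.out).2 hpN)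
  have hord : orderOf d ∣ p ^ k :=
    (Nat.Coprime.of_dvd_left (orderOf_dvd_of_pow_eq_one hK) hcop).dvd_of_dvd_mul_left
      (orderOf_dvd_of_pow_eq_one h1)
  have hd : (d - 1) ^ p ^ k = 0 := by
    rw [sub_pow_char_pow, one_pow, orderOf_dvd_iff_pow_eq_one.1 hord, sub_self]
  exact polytopeClass_stdVertices_sub_one_pow_ne_zero (pow_eq_zero_of_le hk hd)

end Representable

/-! ### Removing biases and induction over layers -/

namespace ReLUNetwork

variable {m n : ℕ}

/-- The function computed by the network after setting all biases to zero. -/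
noncomputable def homEval {m : ℕ} : {n : ℕ} → ReLUNetwork m n → (Fin n → ℝ) → (Fin m → ℝ)
  | _, output A _ => fun x => A.mulVec x
  | _, hidden A _ rest => fun x => rest.homEval (fun i => max 0 (A.mulVec x i))

theorem homEval_smul (net : ReLUNetwork m n) {c : ℝ} (hc : 0 ≤ c) (x : Fin n → ℝ) :
    net.homEval (c • x) = c • net.homEval x := by
  induction net with
  | output A b => exact A.mulVec_smul c x
  | hidden A b rest ih =>
    simp only [homEval]
    rw [← ih]
    congr 1
    ext i
    rw [A.mulVec_smul, Pi.smul_apply, Pi.smul_apply, smul_eq_mul, smul_eq_mul,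
      mul_max_of_nonneg _ _ hc, mul_zero]

theorem exists_abs_affine_sub_le {l : ℕ} (A : Matrix (Fin l) (Fin n) ℝ) (b : Fin l → ℝ) (D : ℝ) :
    ∃ C, ∀ x y : Fin n → ℝ, (∀ j, |x j - y j| ≤ D) →
      ∀ i, |(A.mulVec x + b) i - A.mulVec y i| ≤ C := by
  refine ⟨∑ i, abs ((∑ j, |A i j| * D) + |b i|), fun x y h i => ?_⟩
  have h1 : (A.mulVec x + b) i - A.mulVec y i = ∑ j, A i j * (x j - y j) + b i := by
    simp only [Pi.add_apply, Matrix.mulVec, dotProduct, mul_sub, Finset.sum_sub_distrib]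
    ring
  rw [h1]
  calc |∑ j, A i j * (x j - y j) + b i| ≤ |∑ j, A i j * (x j - y j)| + |b i| := abs_add_le _ _
    _ ≤ (∑ j, |A i j| * D) + |b i| := by
      gcongr
      refine (Finset.abs_sum_le_sum_abs _ _).trans (Finset.sum_le_sum fun j _ => ?_)
      rw [abs_mul]
      exact mul_le_mul_of_nonneg_left (h j) (abs_nonneg _)
    _ ≤ abs ((∑ j, |A i j| * D) + |b i|) := le_abs_self _
    _ ≤ _ := Finset.single_le_sum (f := fun i => abs ((∑ j, |A i j| * D) + |b i|))
      (fun i _ => abs_nonneg _) (Finset.mem_univ i)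

/-- Affine maps and ReLU keep bounded distances bounded; inputs at distance `D` are allowed so that
the induction passes through hidden layers. -/
theorem exists_abs_eval_sub_homEval_le (net : ReLUNetwork m n) (D : ℝ) :
    ∃ C, ∀ x y : Fin n → ℝ, (∀ j, |x j - y j| ≤ D) →
      ∀ i, |net.eval x i - net.homEval y i| ≤ C := by
  induction net generalizing D with
  | output A b => exact exists_abs_affine_sub_le A b D
  | hidden A b rest ih =>
    obtain ⟨D', hD'⟩ := exists_abs_affine_sub_le A b D
    obtain ⟨C, hC⟩ := ih D'
    refine ⟨C, fun x y h i => hC _ _ (fun j => ?_) i⟩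
    refine le_trans ?_ (hD' x y h j)
    rw [max_comm 0, max_comm 0]
    exact abs_max_sub_max_le_abs _ _ _

/-- Both functions are positively homogeneous and their difference is bounded, so scaling forces it
to vanish. -/
theorem homEval_eq_of_represents (net : ReLUNetwork 1 n) {f : (Fin n → ℝ) → ℝ}
    (hf : ∀ (c : ℝ) x, 0 ≤ c → f (c • x) = c * f x) (h : net.Represents f) (x : Fin n → ℝ) :
    net.homEval x 0 = f x := by
  obtain ⟨C, hC⟩ := net.exists_abs_eval_sub_homEval_le 0
  by_contra hne
  have hpos : 0 < |f x - net.homEval x 0| := abs_pos.2 (sub_ne_zero.2 (Ne.symm hne))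
  obtain ⟨c, hc⟩ := exists_nat_gt (C / |f x - net.homEval x 0|)
  rw [div_lt_iff₀ hpos] at hc
  have h1 := hC ((c : ℝ) • x) ((c : ℝ) • x) (by simp) 0
  rw [h, hf _ _ c.cast_nonneg, homEval_smul _ c.cast_nonneg, Pi.smul_apply, smul_eq_mul, ← mul_sub,
    abs_mul, Nat.abs_cast] at h1
  linarith

/-- `G` stands for the layers already traversed, which lets `k` grow along the induction. -/
theorem polytopeRepresentable_homEval {d p N k : ℕ} [Fact p.Prime] (hN : N ≠ 0)
    (net : ReLUNetwork m n) (hw : net.WeightsIn (naryFractions N))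
    {G : (Fin d → ℝ) → Fin n → ℝ} (hG : ∀ j, PolytopeRepresentable p N k (fun x => G x j))
    (i : Fin m) :
    PolytopeRepresentable p N (k + net.numHidden) (fun x => net.homEval (G x) i) := by
  induction net generalizing k with
  | output A b => exact PolytopeRepresentable.mulVec hN hw hG i
  | hidden A b rest ih =>
    have h := ih hw.2 (G := fun x j => max 0 (A.mulVec (G x) j))
      (fun j => (PolytopeRepresentable.mulVec hN hw.1 hG j).relu)
    rw [numHidden, add_comm rest.numHidden 1, ← add_assoc]
    exact h

end ReLUNetwork

theorem maxPool_smul {n : ℕ} (c : ℝ) (x : Fin n → ℝ) (hc : 0 ≤ c) :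
    maxPool n (c • x) = c * maxPool n x := by
  have h : (Fin.cons 0 (c • x) : Fin (n + 1) → ℝ) =
      fun i => c * (Fin.cons 0 x : Fin (n + 1) → ℝ) i := by
    ext i
    refine Fin.cases ?_ (fun i => ?_) i <;> simp
  rw [maxPool, h, maxPool, Finset.mul₀_sup' hc]

/-- If the weights of a network computing the maximum are `N`-ary fractions and the prime `p` does
not divide `N`, then `n < p ^ k`, where `k` is the number of hidden layers. -/
theorem ReLUNetwork.lt_pow_numHidden {n N p : ℕ} (hN : N ≠ 0) (hp : p.Prime) (hpN : ¬ p ∣ N)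
    (net : ReLUNetwork 1 n) (hw : net.WeightsIn (naryFractions N))
    (hnet : net.Represents (maxPool n)) : n < p ^ net.numHidden := by
  have : Fact p.Prime := ⟨hp⟩
  by_contra! hle
  refine not_polytopeRepresentable_maxPool hpN hle ?_
  have h := net.polytopeRepresentable_homEval (p := p) (k := 0) hN hw (G := fun x => x)
    (fun j => PolytopeRepresentable.coord j) 0
  rw [zero_add] at h
  simpa only [net.homEval_eq_of_represents maxPool_smul hnet] using h

theorem mainTheorem2 :
    ∃ C : ℝ, 0 < C ∧ ∀ n N : ℕ, 3 ≤ n → 3 ≤ N → ∀ net : ReLUNetwork 1 n,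
      net.WeightsIn (naryFractions N) → net.Represents (maxPool n) →
        C * (Real.log n / Real.log (Real.log N)) ≤ (net.depth : ℝ) := by
  obtain ⟨c, hc, hprime⟩ := exists_prime_not_dvd_log_le
  refine ⟨1 / c, by positivity, fun n N hn hN net hw hnet => ?_⟩
  obtain ⟨p, hp, hpN, hlog⟩ := hprime N hN
  have hlt := net.lt_pow_numHidden (by omega) hp hpN hw hnet
  have h1 : Real.log n ≤ net.numHidden * Real.log p := by
    rw [← Real.log_pow]
    exact Real.log_le_log (by exact_mod_cast (by omega : 0 < n)) (by exact_mod_cast hlt.le)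
  have hN1 : 1 < Real.log N := log_three_gt_one.trans_le
    (Real.log_le_log (by norm_num) (by exact_mod_cast hN))
  have hpos : 0 < Real.log (Real.log N) := Real.log_pos hN1
  rw [div_mul_div_comm, one_mul, div_le_iff₀ (by positivity)]
  calc Real.log n ≤ net.numHidden * Real.log p := h1
    _ ≤ net.numHidden * (c * Real.log (Real.log N)) := by gcongr
    _ ≤ net.depth * (c * Real.log (Real.log N)) := by
      gcongr
      exact Nat.le_succ _
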